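/- Let $\varphi=(1+\sqrt5)/2$ and let $V$ be a Euclidean space, i.e. a finite-dimensional real inner product space. For $\alpha\in V\setminus\{0\}$ let $r_\alpha(x)=x-\frac{2\langle x,\alpha\rangle}{\langle\alpha,\alpha\rangle}\alpha$ be the reflection in $\alpha^\perp$. Let $T\subset V$ be a finite single-length root-shell system over $\mathbb{Z}[\varphi]$, that is, a finite set such that - (R1) $T=-T$; - (R2) all elements of $T$ have the same positive length; - (R3) $r_\alpha(T)=T$ for every $\alpha\in T$; - (R4) all Cartan coefficients $\frac{2\langle\alpha,\beta\rangle}{\langle\alpha,\alpha\rangle}$, $\alpha,\beta\in T$, lie in $\mathbb{Z}[\varphi]$. Assume that $T$ is indecomposable (it is nonempty and is not the union of two nonempty mutually orthogonal subsets) and non-crystallographic (some Cartan coefficient is not in $\mathbb{Z}$). Then $$\operatorname{rank}(T):=\dim_{\mathbb{R}}\operatorname{span}_{\mathbb{R}}T\in\{2,3,4\},$$ and the reflection group $W=\langle r_\alpha:\alpha\in T\rangle$ is the finite reflection group of type $H_2$, $H_3$ or $H_4$, where the type is $H_n$ with $n=\operatorname{rank}(T)$. Explicitly, let $(m_{ij})$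 be the Coxeter matrix of type $H_n$: $m_{ii}=1$, $m_{n-1,n}=m_{n,n-1}=5$, $m_{ij}=3$ for the other pairs with $|i-j|=1$, and $m_{ij}=2$ for $|i-j|\ge2$. Then $T$ contains a basis $a_1,\dots,a_n$ of $\operatorname{span}_{\mathbb{R}}T$ with $\langle a_i,a_j\rangle=-\cos(\pi/m_{ij})\,\|a_i\|\,\|a_j\|$ for all $i,j$, and $(W,\{r_{a_1},\dots,r_{a_n}\})$ is a Coxeter system with Coxeter matrix $(m_{ij})$. -/

import Mathlib

namespace RootShell

open scoped RealInnerProductSpace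

/-- The ring `ℤ[φ]`, as a subring of the reals, where `φ = (1 + √5) / 2`. -/
noncomputable def goldenIntegers : Subalgebra ℤ ℝ := Algebra.adjoin ℤ {Real.goldenRatio}

/-- The Coxeter matrix of type `H₂ = I₂(5)`; Mathlib's `CoxeterMatrix.I m` is the matrix of the
dihedral type `I₂(m + 2)`. -/
def coxeterMatrixH2 : CoxeterMatrix (Fin 2) := CoxeterMatrix.I 3

theorem coxeterMatrixH2_apply :
    coxeterMatrixH2 0 1 = 5 ∧ coxeterMatrixH2 1 0 = 5 := by
  constructor <;> rfl

variable {V : Type*} [NormedAddCommGroup V] [InnerProductSpace ℝ V]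

/-- The Cartan coefficient `2⟨α, β⟩ / ⟨α, α⟩`. -/
noncomputable def cartanCoeff (α β : V) : ℝ := 2 * ⟪α, β⟫ / ⟪α, α⟫

/-- The orthogonal reflection in the hyperplane perpendicular to `α`. -/
noncomputable def refl (α : V) : V ≃ₗᵢ[ℝ] V := (ℝ ∙ α)ᗮ.reflection

theorem refl_apply (α x : V) : refl α x = x - (2 * ⟪x, α⟫ / ⟪α, α⟫) • α := by
  rw [refl, Submodule.reflection_orthogonal_apply, Submodule.reflection_singleton_apply,
    real_inner_self_eq_norm_sq, real_inner_comm α x, mul_div_assoc, mul_smul]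
  simp [two_smul]

/-- A finite single-length root-shell system in `V` with Cartan coefficients in the ring `R`. -/
structure IsRootShellSystem (R : Subalgebra ℤ ℝ) (T : Set V) : Prop where
  finite : T.Finite
  neg_mem : ∀ α ∈ T, -α ∈ T
  single_length : ∃ r : ℝ, 0 < r ∧ ∀ α ∈ T, ‖α‖ = r
  refl_mem : ∀ α ∈ T, ∀ β ∈ T, refl α β ∈ T
  cartanCoeff_mem : ∀ α ∈ T, ∀ β ∈ T, cartanCoeff α β ∈ R

/-- `T` is nonempty and is not the union of two nonempty mutually orthogonal subsets. -/
def IsIndecomposable (T : Set V) : Prop :=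
  T.Nonempty ∧ ∀ A B : Set V, A ∪ B = T → (∀ a ∈ A, ∀ b ∈ B, ⟪a, b⟫ = 0) → A = ∅ ∨ B = ∅

/-- Some Cartan coefficient is not an integer. -/
def IsNonCrystallographic (T : Set V) : Prop :=
  ∃ α ∈ T, ∃ β ∈ T, ∀ n : ℤ, cartanCoeff α β ≠ n

/-- The rank of `T` is the dimension of its real span. -/
noncomputable def rank (T : Set V) : ℕ := Module.finrank ℝ (Submodule.span ℝ T)

/-- The reflection group generated by the reflections in the elements of `T`. -/
def reflectionGroup (T : Set V) : Subgroup (V ≃ₗᵢ[ℝ] V) := Subgroup.closure (refl '' T)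

theorem refl_mem_reflectionGroup {T : Set V} {α : V} (hα : α ∈ T) :
    refl α ∈ reflectionGroup T :=
  Subgroup.subset_closure ⟨α, hα, rfl⟩

/-- The reflection group of `T` is the finite reflection group with Coxeter matrix `M`:
there are simple roots `a i` in `T` which form a basis of the span of `T` and enclose the angles
`π - π / M i j`, and the reflection group of `T`, together with the reflections in the simple
roots, is a Coxeter system of type `M`. -/
def HasCoxeterType {B : Type*} (T : Set V) (M : CoxeterMatrix B) : Prop :=
  ∃ (a : B → V) (ha : ∀ i, a i ∈ T),
    LinearIndependent ℝ a ∧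
    Submodule.span ℝ (Set.range a) = Submodule.span ℝ T ∧
    (∀ i j, ⟪a i, a j⟫ = -Real.cos (Real.pi / M i j) * (‖a i‖ * ‖a j‖)) ∧
    ∃ cs : CoxeterSystem M (reflectionGroup T),
      ∀ i, cs.simple i = ⟨refl (a i), refl_mem_reflectionGroup (ha i)⟩

end RootShell

/-!
The finite set of Cartan coefficients is stable under `x ↦ x ^ 2 - 2`. This map commutes with the
conjugation `φ ↦ ψ` of `ℤ[φ]`, so the conjugates of the coefficients lie in `[-2, 2]` as well, and
the coefficient of two distinct simple roots can only be `0`, `-1`, `-φ` or `1 - φ`. The last value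
would give a root with coordinates of both signs, so the Coxeter diagram of `T` is a connected graph
with edge labels `3` and `5`. Since every root is obtained from a simple one by simple reflections,
a non-integral coefficient forces an edge labelled `5`, and positivity of the inner product excludes
every connected diagram with such an edge except `H₂`, `H₃` and `H₄`.
The reflection group is identified with the abstract Coxeter group by Tits' argument: the geometric
representation of a Coxeter group is faithful because an element `w` sends the simple root `a i` to
a positive vector whenever `w` does not have `i` as a right descent.
-/

namespace RootShell

open scoped RealInnerProductSpace goldenRatio NNReal
open Real (sin cos pi)

variable {V : Type*} [NormedAddCommGroup V] [InnerProductSpace ℝ V]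

/-! ### Bounding Cartan coefficients by conjugation -/

theorem exists_int_of_mem_goldenIntegers {x : ℝ} (hx : x ∈ goldenIntegers) :
    ∃ a b : ℤ, x = a + b * φ := by
  induction hx using Algebra.adjoin_induction with
  | mem x hx => exact ⟨0, 1, by simp_all⟩
  | algebraMap n => exact ⟨n, 0, by simp⟩
  | add x y _ _ ihx ihy =>
    obtain ⟨a, b, rfl⟩ := ihx
    obtain ⟨c, d, rfl⟩ := ihy
    exact ⟨a + c, b + d, by push_cast; ring⟩
  | mul x y _ _ ihx ihy =>
    obtain ⟨a, b, rfl⟩ := ihx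
    obtain ⟨c, d, rfl⟩ := ihy
    refine ⟨a * c + b * d, a * d + b * c + b * d, ?_⟩
    push_cast
    linear_combination (b * d : ℝ) * Real.goldenRatio_sq

theorem int_add_int_mul_goldenRatio_injective :
    Function.Injective fun p : ℤ × ℤ ↦ (p.1 + p.2 * φ : ℝ) := by
  rintro ⟨a, b⟩ ⟨c, d⟩ h
  have hφ : (b - d) * φ = c - a := by simp only at h; linarith
  have hbd : b = d := by
    by_contra hne
    have hne' : (b - d : ℝ) ≠ 0 := sub_ne_zero.2 (by exact_mod_cast hne)
    refine Real.goldenRatio_irrational ⟨(c - a) / (b - d), ?_⟩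
    push_cast
    rw [← hφ, mul_div_cancel_left₀ _ hne']
  subst hbd
  rw [sub_self, zero_mul, eq_comm, sub_eq_zero, Int.cast_inj] at hφ
  rw [hφ]

theorem abs_goldenConj_le_two_of_stable {C : Set ℝ} (hfin : C.Finite)
    (hC : ∀ x ∈ C, x ^ 2 - 2 ∈ C) {a b : ℤ} (hab : (a + b * φ : ℝ) ∈ C) :
    |(a + b * ψ : ℝ)| ≤ 2 := by
  obtain ⟨⟨c, d⟩, hcd, hmax⟩ :=
    ((fun p : ℤ × ℤ ↦ (p.1 + p.2 * φ : ℝ)) ⁻¹' C).exists_max_image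
      (fun p ↦ |(p.1 + p.2 * ψ : ℝ)|)
      (hfin.preimage int_add_int_mul_goldenRatio_injective.injOn) ⟨(a, b), hab⟩
  -- `x ↦ x ^ 2 - 2` commutes with conjugation, so the largest `t = |x'|` satisfies `t ^ 2 - 2 ≤ t`.
  have hsq := hmax (c ^ 2 + d ^ 2 - 2, 2 * c * d + d ^ 2) <| by
    have hsq_mem := hC _ hcd
    rw [Set.mem_preimage]
    convert! hsq_mem using 1
    push_cast
    linear_combination -(d ^ 2 : ℝ) * Real.goldenRatio_sq
  have hconj : ((c ^ 2 + d ^ 2 - 2 : ℤ) + (2 * c * d + d ^ 2 : ℤ) * ψ : ℝ) =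
      |(c + d * ψ : ℝ)| ^ 2 - 2 := by
    rw [sq_abs]
    push_cast
    linear_combination -(d ^ 2 : ℝ) * Real.goldenConj_sq
  simp only [hconj] at hsq
  have hle := le_abs_self (|(c + d * ψ : ℝ)| ^ 2 - 2)
  have hab_le := hmax (a, b) hab
  simp only at hab_le
  nlinarith [abs_nonneg (c + d * ψ : ℝ)]

theorem goldenInteger_cases {a b : ℤ} (hgt : -2 < (a + b * φ : ℝ)) (hle : (a + b * φ : ℝ) ≤ 0)
    (hconj : |(a + b * ψ : ℝ)| ≤ 2) :
    (a + b * φ : ℝ) = 0 ∨ (a + b * φ : ℝ) = -1 ∨ (a + b * φ : ℝ) = -φ ∨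
      (a + b * φ : ℝ) = 1 - φ := by
  obtain ⟨hconj₁, hconj₂⟩ := abs_le.1 hconj
  have hψ : ψ = 1 - φ := by linarith [Real.goldenRatio_add_goldenConj]
  have hφ₁ : (8 / 5 : ℝ) < φ := by nlinarith [Real.goldenRatio_sq, Real.goldenRatio_pos]
  have hφ₂ : φ < 2 := Real.goldenRatio_lt_two
  rw [hψ] at hconj₁ hconj₂
  have hb₁ : -2 < b := by
    by_contra! hb
    have : (b : ℝ) ≤ -2 := by exact_mod_cast hb
    nlinarith
  have hb₂ : b < 1 := by
    by_contra! hb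
    have : (1 : ℝ) ≤ b := by exact_mod_cast hb
    nlinarith
  obtain rfl | rfl : b = 0 ∨ b = -1 := by omega
  · simp only [Int.cast_zero, zero_mul, add_zero] at hgt hle ⊢
    have : -2 < a := by exact_mod_cast hgt
    have : a ≤ 0 := by exact_mod_cast hle
    obtain rfl | rfl : a = 0 ∨ a = -1 := by omega
    all_goals simp
  · push_cast at hgt hconj₁ hconj₂ hle ⊢
    have : a < 2 := by exact_mod_cast (by linarith : (a : ℝ) < 2)
    have : -1 < a := by exact_mod_cast (by linarith : (-1 : ℝ) < a)
    obtain rfl | rfl : a = 0 ∨ a = 1 := by omega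
    · exact .inr (.inr (.inl (by simp)))
    · exact .inr (.inr (.inr (by push_cast; ring)))

/-! ### Reflections and dihedral groups -/

theorem refl_eq_sub_cartanCoeff (α x : V) : refl α x = x - cartanCoeff α x • α := by
  rw [refl_apply, cartanCoeff, real_inner_comm]

theorem refl_self (α : V) : refl α α = -α :=
  Submodule.reflection_orthogonalComplement_singleton_eq_neg α

@[simp]
theorem refl_mul_self (α : V) : refl α * refl α = 1 :=
  Submodule.reflection_mul_reflection _

@[simp]
theorem refl_refl (α x : V) : refl α (refl α x) = x :=
  Submodule.reflection_reflection _ x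

theorem conj_refl (g : V ≃ₗᵢ[ℝ] V) (α : V) : g * refl α * g⁻¹ = refl (g α) := by
  rw [mul_inv_eq_iff_eq_mul]
  ext x
  simp only [LinearIsometryEquiv.coe_mul, Function.comp_apply, refl_eq_sub_cartanCoeff,
    cartanCoeff, map_sub, LinearIsometryEquiv.map_smul, LinearIsometryEquiv.inner_map_map]

theorem cartanCoeff_comm {α β : V} (h : ‖α‖ = ‖β‖) : cartanCoeff α β = cartanCoeff β α := by
  simp only [cartanCoeff, real_inner_self_eq_norm_sq, h, real_inner_comm]

theorem cartanCoeff_self {α : V} (h : α ≠ 0) : cartanCoeff α α = 2 := by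
  rw [cartanCoeff, mul_div_assoc, div_self (by simpa using h), mul_one]

theorem inner_eq_cartanCoeff (α β : V) : ⟪α, β⟫ = cartanCoeff α β / 2 * ‖α‖ ^ 2 := by
  rcases eq_or_ne α 0 with rfl | hα
  · simp
  · rw [cartanCoeff, real_inner_self_eq_norm_sq]
    field_simp [norm_ne_zero_iff.2 hα]

theorem refl_apply_of_inner_eq_zero {x z : V} (h : ⟪x, z⟫ = 0) : refl x z = z := by
  rw [refl_eq_sub_cartanCoeff, cartanCoeff, h, mul_zero, zero_div, zero_smul, sub_zero]

theorem inner_eq_zero_of_cartanCoeff_eq_zero {α β : V} (h : cartanCoeff α β = 0) :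
    ⟪α, β⟫ = 0 := by
  rw [inner_eq_cartanCoeff, h, zero_div, zero_mul]

/-- The vector `sin (t + θ) x + sin t y`. If `x` and `y` are the simple roots of a dihedral group
and enclose the angle `π - θ`, the phases `t ∈ ℤ θ` give, up to scaling, its roots. -/
noncomputable def dihedralVector (θ : ℝ) (x y : V) (t : ℝ) : V := sin (t + θ) • x + sin t • y

section Dihedral

variable {x y : V} {θ : ℝ}

theorem refl_dihedralVector (hxy : cartanCoeff x y = -2 * cos θ) (t : ℝ) :
    refl x (dihedralVector θ y x t) = dihedralVector θ x y (t + θ) := by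
  have hsin : sin (t + θ + θ) = 2 * cos θ * sin (t + θ) - sin t := by
    have hsub : sin t = sin (t + θ - θ) := by rw [add_sub_cancel_right]
    rw [hsub, Real.sin_add (t + θ) θ, Real.sin_sub]
    ring
  have hy : refl x y = y + (2 * cos θ) • x := by
    rw [refl_eq_sub_cartanCoeff, hxy]
    module
  rw [dihedralVector, dihedralVector, map_add, map_smul, map_smul, hy, refl_self, hsin]
  module

theorem refl_mul_refl_pow_dihedralVector (hxy : cartanCoeff x y = -2 * cos θ)
    (hyx : cartanCoeff y x = -2 * cos θ) (n : ℕ) (t : ℝ) :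
    ((refl x * refl y) ^ n) (dihedralVector θ x y t) = dihedralVector θ x y (t + 2 * n * θ) := by
  induction n generalizing t with
  | zero => simp
  | succ n ih =>
    rw [pow_succ, LinearIsometryEquiv.coe_mul, Function.comp_apply, LinearIsometryEquiv.coe_mul,
      Function.comp_apply, refl_dihedralVector hyx, refl_dihedralVector hxy, ih]
    congr 1
    push_cast
    ring

theorem refl_mul_refl_pow_apply_of_inner_eq_zero {z : V} (hx : ⟪x, z⟫ = 0) (hy : ⟪y, z⟫ = 0)
    (n : ℕ) : ((refl x * refl y) ^ n) z = z := by
  have hiter : ⇑((refl x * refl y) ^ n) = (refl x * refl y)^[n] :=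
    hom_coe_pow _ rfl (fun _ _ ↦ rfl) _ _
  rw [hiter]
  refine Function.iterate_fixed ?_ n
  rw [LinearIsometryEquiv.coe_mul, Function.comp_apply, refl_apply_of_inner_eq_zero hy,
    refl_apply_of_inner_eq_zero hx]

theorem sin_pi_div_nat_pos {m : ℕ} (hm : 2 ≤ m) : 0 < sin (pi / m) := by
  have hm' : (2 : ℝ) ≤ m := by exact_mod_cast hm
  refine Real.sin_pos_of_pos_of_lt_pi (by positivity) ?_
  exact div_lt_self Real.pi_pos (by linarith)

theorem refl_mul_refl_pow_eq_one {m : ℕ} (hm : 2 ≤ m)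
    (hxy : cartanCoeff x y = -2 * cos (pi / m)) (hyx : cartanCoeff y x = -2 * cos (pi / m)) :
    (refl x * refl y) ^ m = 1 := by
  have hm0 : (m : ℝ) * (pi / m) = pi := mul_div_cancel₀ pi (by positivity)
  have hfix (t : ℝ) : ((refl x * refl y) ^ m) (dihedralVector (pi / m) x y t) =
      dihedralVector (pi / m) x y t := by
    rw [refl_mul_refl_pow_dihedralVector hxy hyx, mul_assoc, hm0, dihedralVector, dihedralVector,
      add_right_comm, Real.sin_add_two_pi, Real.sin_add_two_pi]
  have hsin := (sin_pi_div_nat_pos hm).ne'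
  have hx : ((refl x * refl y) ^ m) x = x := by
    simpa [dihedralVector, hsin] using hfix 0
  have hy : ((refl x * refl y) ^ m) y = y := by
    simpa [dihedralVector, hsin] using hfix (-(pi / m))
  set g := (refl x * refl y) ^ m
  have hperp : ∀ z ∈ (Submodule.span ℝ {x, y})ᗮ, g z = z := fun z hz ↦
    refl_mul_refl_pow_apply_of_inner_eq_zero (hz x (Submodule.subset_span (by simp)))
      (hz y (Submodule.subset_span (by simp))) m
  have hspan : Submodule.span ℝ {x, y} ≤ LinearMap.eqLocus (g : V →ₗ[ℝ] V) LinearMap.id :=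
    Submodule.span_le.2 (by rintro _ (rfl | rfl) <;> assumption)
  have : FiniteDimensional ℝ (Submodule.span ℝ {x, y}) :=
    FiniteDimensional.span_of_finite ℝ (Set.toFinite _)
  have htop : LinearMap.eqLocus (g : V →ₗ[ℝ] V) LinearMap.id = ⊤ := by
    rw [eq_top_iff, ← Submodule.sup_orthogonal_of_hasOrthogonalProjection (K := .span ℝ {x, y})]
    exact sup_le hspan hperp
  ext z
  exact (htop ▸ Submodule.mem_top : z ∈ LinearMap.eqLocus (g : V →ₗ[ℝ] V) LinearMap.id)

theorem dihedralVector_apply_pos {m k : ℕ} (hm : 2 ≤ m) (hk : k < m) {f : Module.Dual ℝ V}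
    (hx : 0 < f x) (hy : 0 < f y) : 0 < f (dihedralVector (pi / m) x y (k * (pi / m))) := by
  have hm0 : (0 : ℝ) < m := by positivity
  have hstep : (0 : ℝ) < pi / m := by positivity
  have hle : k * (pi / m) + pi / m ≤ pi := by
    have hk' : (k + 1 : ℝ) ≤ m := by exact_mod_cast hk
    calc k * (pi / m) + pi / m = (k + 1) * (pi / m) := by ring
      _ ≤ m * (pi / m) := by gcongr
      _ = pi := mul_div_cancel₀ pi hm0.ne'
  have hx_coeff : 0 ≤ sin (k * (pi / m) + pi / m) :=
    Real.sin_nonneg_of_nonneg_of_le_pi (by positivity) hle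
  rw [dihedralVector, map_add, map_smul, map_smul, smul_eq_mul, smul_eq_mul]
  rcases Nat.eq_zero_or_pos k with rfl | hk0
  · have := sin_pi_div_nat_pos hm
    simpa using mul_pos this hx
  · have hy_coeff : 0 < sin (k * (pi / m)) :=
      Real.sin_pos_of_pos_of_lt_pi (by positivity) (by linarith)
    positivity

end Dihedral

/-- The Cartan coefficients of the vectors `a i` are those of simple roots of equal length which
enclose the angles `π - π / M i j`. An entry `M i j = 0` stands for `m = ∞`; since `π / 0 = 0`, it
prescribes the Cartan coefficient `-2`. -/
def HasCoxeterAngles {B : Type*} (a : B → V) (M : CoxeterMatrix B) : Prop :=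
  ∀ i j, cartanCoeff (a i) (a j) = -2 * cos (pi / M i j)

namespace HasCoxeterAngles

variable {B : Type*} {a : B → V} {M : CoxeterMatrix B} (ha : HasCoxeterAngles a M)
include ha

theorem isLiftable : M.IsLiftable fun i ↦ refl (a i) := by
  intro i j
  rcases eq_or_ne i j with rfl | hij
  · rw [M.diagonal, pow_one, refl_mul_self]
  rcases Nat.eq_zero_or_pos (M i j) with h0 | hpos
  · rw [h0, pow_zero]
  · have hm : 2 ≤ M i j := by have := M.off_diagonal i j hij; omega
    exact refl_mul_refl_pow_eq_one hm (ha i j) (by rw [ha j i, M.symmetric])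

theorem matrix_ne_zero {f : Module.Dual ℝ V} (hf : ∀ i, 0 < f (a i)) (i j : B) : M i j ≠ 0 := by
  intro h0
  have hij := inner_eq_cartanCoeff (a i) (a j)
  have hji := inner_eq_cartanCoeff (a j) (a i)
  rw [ha, M.symmetric, h0] at hji
  rw [ha, h0] at hij
  have hsum : a i + a j = 0 := by
    rw [← norm_eq_zero, ← sq_eq_zero_iff, norm_add_sq_real]
    rw [real_inner_comm] at hji
    norm_num at hij hji
    linarith
  have := congrArg f hsum
  rw [map_add, map_zero] at this
  linarith [hf i, hf j]

end HasCoxeterAngles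

/-! ### Faithfulness of the geometric representation -/

section ReducedExtension

open CoxeterSystem (alternatingWord)

variable {B W : Type*} [Group W] {M : CoxeterMatrix B}

/-- Appending the word `j, i, j, …` with `k + 1` letters to `v` increases the length by `k + 1`.
Mathlib's alternating words are read from their end, whence the inverse. -/
def IsReducedExtension (cs : CoxeterSystem M W) (v : W) (i j : B) (k : ℕ) : Prop :=
  cs.length (v * (cs.wordProd (alternatingWord i j (k + 1)))⁻¹) = cs.length v + (k + 1)

variable {cs : CoxeterSystem M W} {v : W} {i j : B} {k : ℕ}

theorem IsReducedExtension.lt_matrix (h0 : M i j ≠ 0)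
    (h : IsReducedExtension cs v i j k) : k < M i j := by
  by_contra! hk
  refine cs.not_isReduced_alternatingWord i j h0 (m := k + 1) (by omega) ?_
  have h₁ := cs.length_mul_le v (cs.wordProd (alternatingWord i j (k + 1)))⁻¹
  have h₂ := cs.length_wordProd_le (alternatingWord i j (k + 1))
  rw [h, cs.length_inv] at h₁
  rw [CoxeterSystem.length_alternatingWord] at h₂
  rw [CoxeterSystem.IsReduced, CoxeterSystem.length_alternatingWord]
  omega

theorem IsReducedExtension.not_isRightDescent
    (h : IsReducedExtension cs v i j k) : ¬ cs.IsRightDescent v j := by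
  intro hj
  rw [cs.isRightDescent_iff] at hj
  have hle := cs.length_mul_le (v * cs.simple j)
    (cs.wordProd (alternatingWord j i k))⁻¹
  have hword := cs.length_wordProd_le (alternatingWord j i k)
  rw [CoxeterSystem.length_alternatingWord] at hword
  rw [IsReducedExtension, CoxeterSystem.alternatingWord_succ, cs.wordProd_concat, mul_inv_rev,
    cs.inv_simple, ← mul_assoc] at h
  rw [h, cs.length_inv] at hle
  omega

theorem IsReducedExtension.mul_simple
    (h : IsReducedExtension cs v i j k) (hi : cs.IsRightDescent v i) :
    IsReducedExtension cs (v * cs.simple i) j i (k + 1) := by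
  rw [cs.isRightDescent_iff] at hi
  rw [IsReducedExtension, CoxeterSystem.alternatingWord_succ, cs.wordProd_concat, mul_inv_rev,
    cs.inv_simple, ← mul_assoc, cs.simple_mul_simple_cancel_right, h]
  omega

theorem isReducedExtension_zero_iff :
    IsReducedExtension cs v i j 0 ↔ ¬ cs.IsRightDescent v j := by
  rw [cs.not_isRightDescent_iff, IsReducedExtension, zero_add, CoxeterSystem.alternatingWord_succ,
    cs.wordProd_concat]
  rw [show alternatingWord j i 0 = [] from rfl, cs.wordProd_nil, one_mul, cs.inv_simple]

end ReducedExtension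

namespace HasCoxeterAngles

variable {B : Type*} {a : B → V} {M : CoxeterMatrix B} (ha : HasCoxeterAngles a M)
  {W : Type*} [Group W] (cs : CoxeterSystem M W)

/-- The geometric representation of the Coxeter group of `M`, in which the simple generator `i`
acts as the reflection in `a i`. -/
noncomputable def reflectionRep : W →* (V ≃ₗᵢ[ℝ] V) :=
  cs.lift ⟨fun i ↦ refl (a i), ha.isLiftable⟩

theorem reflectionRep_simple (i : B) : ha.reflectionRep cs (cs.simple i) = refl (a i) :=
  cs.lift_apply_simple ha.isLiftable i

theorem reflectionRep_mul_simple_apply (v : W) (i : B) (x : V) :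
    ha.reflectionRep cs (v * cs.simple i) x = ha.reflectionRep cs v (refl (a i) x) := by
  rw [map_mul, reflectionRep_simple, LinearIsometryEquiv.coe_mul, Function.comp_apply]

theorem reflectionRep_mul_simple_dihedralVector (v : W) (i j : B) (t : ℝ) :
    ha.reflectionRep cs (v * cs.simple i) (dihedralVector (pi / M i j) (a i) (a j) (t + pi / M i j))
      = ha.reflectionRep cs v (dihedralVector (pi / M i j) (a j) (a i) t) := by
  rw [reflectionRep_mul_simple_apply, ← refl_dihedralVector (ha i j), refl_refl]

variable {f : Module.Dual ℝ V}

include ha in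
theorem two_le_matrix (hf : ∀ i, 0 < f (a i)) {i j : B} (hij : i ≠ j) : 2 ≤ M i j := by
  have h0 := ha.matrix_ne_zero hf i j
  have h1 := M.off_diagonal i j hij
  omega

theorem reflectionRep_apply_pos_of_dihedralVector (hf : ∀ i, 0 < f (a i)) {v : W} {j : B}
    (hj : ¬ cs.IsRightDescent v j)
    (h : ∀ t, t ≠ j → cs.IsRightDescent v t →
      0 < f (ha.reflectionRep cs v (dihedralVector (pi / M t j) (a j) (a t) 0))) :
    0 < f (ha.reflectionRep cs v (a j)) := by
  rcases eq_or_ne v 1 with rfl | hv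
  · simpa using hf j
  obtain ⟨t, ht⟩ := cs.exists_rightDescent_of_ne_one hv
  have htj : t ≠ j := fun h ↦ hj (h ▸ ht)
  have hpos := h t htj ht
  rw [dihedralVector, zero_add, Real.sin_zero, zero_smul, add_zero, map_smul, map_smul,
    smul_eq_mul] at hpos
  exact pos_of_mul_pos_right hpos (sin_pi_div_nat_pos (ha.two_le_matrix hf htj)).le

theorem reflectionRep_dihedralVector_pos (hf : ∀ i, 0 < f (a i)) {v : W} {i j : B} {k : ℕ}
    (hij : i ≠ j) (hv : IsReducedExtension cs v i j k) :
    0 < f (ha.reflectionRep cs v (dihedralVector (pi / M i j) (a j) (a i) (k * (pi / M i j)))) := by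
  induction hn : cs.length v using Nat.strong_induction_on generalizing v i j k with
  | _ n ih =>
    have of_descent {i j : B} {k : ℕ} (hij : i ≠ j) (hv : IsReducedExtension cs v i j k)
        (hi : cs.IsRightDescent v i) : 0 < f (ha.reflectionRep cs v
          (dihedralVector (pi / M i j) (a j) (a i) (k * (pi / M i j)))) := by
      have := ih _ (hn ▸ hi) hij.symm (hv.mul_simple hi) rfl
      rwa [M.symmetric j i, Nat.cast_add_one, add_one_mul,
        reflectionRep_mul_simple_dihedralVector] at this
    have simple_pos {j : B} (hj : ¬ cs.IsRightDescent v j) : 0 < f (ha.reflectionRep cs v (a j)) :=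
      ha.reflectionRep_apply_pos_of_dihedralVector cs hf hj fun t htj ht ↦ by
        simpa using of_descent htj (isReducedExtension_zero_iff.2 hj) ht
    by_cases hi : cs.IsRightDescent v i
    · exact of_descent hij hv hi
    · exact dihedralVector_apply_pos (f := f ∘ₗ (ha.reflectionRep cs v : V →ₗ[ℝ] V))
        (ha.two_le_matrix hf hij) (hv.lt_matrix (ha.matrix_ne_zero hf i j))
        (simple_pos hv.not_isRightDescent) (simple_pos hi)

theorem reflectionRep_apply_pos (hf : ∀ i, 0 < f (a i)) {v : W} {j : B}
    (hj : ¬ cs.IsRightDescent v j) : 0 < f (ha.reflectionRep cs v (a j)) :=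
  ha.reflectionRep_apply_pos_of_dihedralVector cs hf hj fun _ htj _ ↦ by
    simpa using ha.reflectionRep_dihedralVector_pos cs hf htj (isReducedExtension_zero_iff.2 hj)

theorem reflectionRep_injective (hf : ∀ i, 0 < f (a i)) :
    Function.Injective (ha.reflectionRep cs) := by
  rw [injective_iff_map_eq_one]
  intro g hg
  by_contra hg1
  obtain ⟨t, ht⟩ := cs.exists_rightDescent_of_ne_one hg1
  have hneg := ha.reflectionRep_apply_pos cs hf (cs.isRightDescent_iff_not_isRightDescent_mul.1 ht)
  rw [reflectionRep_mul_simple_apply, hg, refl_self] at hneg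
  simp only [LinearIsometryEquiv.coe_one, id_eq, map_neg, neg_pos] at hneg
  exact hneg.not_gt (hf t)

theorem range_reflectionRep :
    (ha.reflectionRep cs).range = Subgroup.closure (Set.range fun i ↦ refl (a i)) := by
  rw [MonoidHom.range_eq_map, ← cs.subgroup_closure_range_simple, MonoidHom.map_closure,
    ← Set.range_comp]
  congr 2
  funext i
  exact ha.reflectionRep_simple cs i

include ha in
theorem exists_coxeterSystem (hf : ∀ i, 0 < f (a i)) {G : Subgroup (V ≃ₗᵢ[ℝ] V)}
    (hG : Subgroup.closure (Set.range fun i ↦ refl (a i)) = G) :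
    ∃ cs : CoxeterSystem M G, ∀ i, (cs.simple i : V ≃ₗᵢ[ℝ] V) = refl (a i) := by
  let e : M.Group ≃* G :=
    (MonoidHom.ofInjective (ha.reflectionRep_injective M.toCoxeterSystem hf)).trans
      (MulEquiv.subgroupCongr ((ha.range_reflectionRep _).trans hG))
  exact ⟨⟨e.symm⟩, ha.reflectionRep_simple M.toCoxeterSystem⟩

end HasCoxeterAngles

/-! ### Simple systems -/

namespace IsRootShellSystem

variable {R : Subalgebra ℤ ℝ} {T : Set V} (hT : IsRootShellSystem R T)
include hT

theorem norm_eq {α β : V} (hα : α ∈ T) (hβ : β ∈ T) : ‖α‖ = ‖β‖ := by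
  obtain ⟨r, -, hr⟩ := hT.single_length
  rw [hr α hα, hr β hβ]

theorem ne_zero {α : V} (hα : α ∈ T) : α ≠ 0 := by
  obtain ⟨r, hr0, hr⟩ := hT.single_length
  rw [← norm_pos_iff, hr α hα]
  exact hr0

theorem cartanCoeff_comm {α β : V} (hα : α ∈ T) (hβ : β ∈ T) :
    cartanCoeff α β = cartanCoeff β α :=
  RootShell.cartanCoeff_comm (hT.norm_eq hα hβ)

end IsRootShellSystem

section Cone

theorem apply_nonneg_of_mem_cone {Δ : Set V} {f : Module.Dual ℝ V} (hf : ∀ γ ∈ Δ, 0 ≤ f γ) {x : V}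
    (hx : x ∈ Submodule.span ℝ≥0 Δ) : 0 ≤ f x := by
  induction hx using Submodule.span_induction with
  | mem x hx => exact hf x hx
  | zero => rw [map_zero]
  | add x y _ _ hx hy => rw [map_add]; exact add_nonneg hx hy
  | smul r x _ hx => rw [NNReal.smul_def, map_smul]; exact mul_nonneg r.2 hx

theorem smul_ne_smul_add_of_notMem_cone {Δ : Set V} {f : Module.Dual ℝ V}
    (hf : ∀ γ ∈ Δ, 0 < f γ) {α β γ : V} (hα : α ∈ Δ) (hβ : β ∈ Δ) (hne : α ≠ β)
    (hmin : β ∉ Submodule.span ℝ≥0 (Δ \ {β})) (hγ : γ ∈ Submodule.span ℝ≥0 Δ)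
    (x : ℝ) {y : ℝ} (hy : 0 < y) : x • β ≠ y • α + γ := by
  intro h
  rw [← Set.insert_sdiff_self_of_mem hβ, Submodule.mem_span_insert] at hγ
  obtain ⟨t, δ, hδ, rfl⟩ := hγ
  have hβ_eq : (x - t) • β = y • α + δ := by
    rw [sub_smul, h, NNReal.smul_def]
    abel
  have hfδ : 0 ≤ f δ := apply_nonneg_of_mem_cone (fun γ hγ ↦ (hf γ hγ.1).le) hδ
  have hpos : 0 < x - t := by
    refine pos_of_mul_pos_left ?_ (hf β hβ).le
    rw [← smul_eq_mul, ← map_smul, hβ_eq, map_add, map_smul, smul_eq_mul]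
    exact add_pos_of_pos_of_nonneg (mul_pos hy (hf α hα)) hfδ
  have hα' : α ∈ Submodule.span ℝ≥0 (Δ \ {β}) := Submodule.subset_span ⟨hα, hne⟩
  have hmem : (x - t)⁻¹ • (y • α + δ) ∈ Submodule.span ℝ≥0 (Δ \ {β}) :=
    Submodule.smul_mem _ (⟨_, (inv_pos.2 hpos).le⟩ : ℝ≥0)
      (Submodule.add_mem _ (Submodule.smul_mem _ (⟨y, hy.le⟩ : ℝ≥0) hα') hδ)
  rw [← hβ_eq, inv_smul_smul₀ hpos.ne'] at hmem
  exact hmin hmem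

theorem exists_minimal_cone_generators {P : Set V} (hP : P.Finite) :
    ∃ Δ ⊆ P, P ⊆ Submodule.span ℝ≥0 Δ ∧ ∀ β ∈ Δ, β ∉ Submodule.span ℝ≥0 (Δ \ {β}) := by
  obtain ⟨Δ, ⟨hΔ, hgen⟩, hmin⟩ := (hP.finite_subsets.subset
    fun Δ (h : Δ ⊆ P ∧ P ⊆ Submodule.span ℝ≥0 Δ) ↦ h.1).exists_minimal
      ⟨P, subset_rfl, Submodule.subset_span⟩
  refine ⟨Δ, hΔ, hgen, fun β hβ hmem ↦ ?_⟩
  have hspan : Submodule.span ℝ≥0 (Δ \ {β}) = Submodule.span ℝ≥0 Δ := by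
    rw [← Submodule.span_insert_eq_span hmem, Set.insert_sdiff_self_of_mem hβ]
  have hsub : Δ ⊆ Δ \ {β} :=
    hmin ⟨Set.sdiff_subset.trans hΔ, by rwa [hspan]⟩ Set.sdiff_subset
  exact (hsub hβ).2 rfl

end Cone

/-- `a` is the simple system of `T` for the notion of positivity given by the functional `f`: a
linearly independent family of positive roots whose cone contains every positive root. -/
structure IsSimpleSystem {B : Type*} (T : Set V) (f : Module.Dual ℝ V) (a : B → V) : Prop where
  mem : ∀ i, a i ∈ T
  pos : ∀ i, 0 < f (a i)
  linearIndependent : LinearIndependent ℝ a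
  regular : ∀ β ∈ T, f β ≠ 0
  mem_cone : ∀ β ∈ T, 0 < f β → β ∈ Submodule.span ℝ≥0 (Set.range a)

namespace IsRootShellSystem

variable {R : Subalgebra ℤ ℝ} {T : Set V} (hT : IsRootShellSystem R T)
include hT

theorem inner_nonpos_of_minimal {f : Module.Dual ℝ V} (hf : ∀ β ∈ T, f β ≠ 0) {Δ : Set V}
    (hΔ : Δ ⊆ {β ∈ T | 0 < f β}) (hgen : {β ∈ T | 0 < f β} ⊆ Submodule.span ℝ≥0 Δ)
    (hmin : ∀ β ∈ Δ, β ∉ Submodule.span ℝ≥0 (Δ \ {β})) {α β : V} (hα : α ∈ Δ) (hβ : β ∈ Δ)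
    (hne : α ≠ β) : ⟪α, β⟫ ≤ 0 := by
  by_contra! hinner
  have hpos : ∀ γ ∈ Δ, 0 < f γ := fun γ hγ ↦ (hΔ hγ).2
  have hk : 0 < cartanCoeff α β :=
    div_pos (by linarith) (real_inner_self_pos.2 (hT.ne_zero (hΔ hα).1))
  have hmem := hT.refl_mem α (hΔ hα).1 β (hΔ hβ).1
  have hrefl := refl_eq_sub_cartanCoeff α β
  rcases (hf _ hmem).lt_or_gt with hneg | hpos'
  · have hγ := hgen ⟨hT.neg_mem _ hmem, by simpa using hneg⟩
    refine smul_ne_smul_add_of_notMem_cone hpos hβ hα hne.symm (hmin α hα) hγ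
      (cartanCoeff α β) one_pos ?_
    rw [hrefl]
    module
  · refine smul_ne_smul_add_of_notMem_cone hpos hα hβ hne (hmin β hβ) (hgen ⟨hmem, hpos'⟩) 1 hk ?_
    rw [hrefl]
    module

theorem exists_isSimpleSystem :
    ∃ (Δ : Finset V) (f : Module.Dual ℝ V), IsSimpleSystem T f ((↑) : Δ → V) := by
  have := hT.finite.to_subtype
  obtain ⟨f, hf⟩ : ∃ f : Module.Dual ℝ V, ∀ β : T, f β ≠ 0 :=
    Module.exists_dual_forall_apply_ne_zero _ fun β ↦ hT.ne_zero β.2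
  rw [Subtype.forall] at hf
  have hfin : {β ∈ T | 0 < f β}.Finite := hT.finite.subset (Set.sep_subset _ _)
  obtain ⟨Δ, hΔ, hgen, hmin⟩ := exists_minimal_cone_generators hfin
  lift Δ to Finset V using hfin.subset hΔ
  refine ⟨Δ, f, fun i ↦ (hΔ i.2).1, fun i ↦ (hΔ i.2).2, ?_, hf, fun β hβ hpos ↦ ?_⟩
  · refine LinearMap.BilinForm.linearIndependent_of_pairwise_le_zero (innerₗ V)
      (fun x hx ↦ real_inner_self_pos.2 hx) f _ (fun i ↦ (hΔ i.2).2) fun i j hij ↦ ?_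
    exact hT.inner_nonpos_of_minimal hf hΔ hgen hmin i.2 j.2 (Subtype.coe_injective.ne hij)
  · rw [Subtype.range_coe]
    exact hgen ⟨hβ, hpos⟩

end IsRootShellSystem

namespace IsSimpleSystem

variable {B : Type*} {R : Subalgebra ℤ ℝ} {T : Set V} {f : Module.Dual ℝ V} {a : B → V}

theorem comp_equiv {B' : Type*} (hS : IsSimpleSystem T f a) (e : B' ≃ B) :
    IsSimpleSystem T f (a ∘ e) where
  mem i := hS.mem _
  pos i := hS.pos _
  linearIndependent := hS.linearIndependent.comp _ e.injective
  regular := hS.regular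
  mem_cone β hβ hpos := by rw [EquivLike.range_comp]; exact hS.mem_cone β hβ hpos

variable (hS : IsSimpleSystem T f a) (hT : IsRootShellSystem R T)
include hS

theorem exists_coeff_nonneg {β : V} (hβ : β ∈ T) (hpos : 0 < f β) :
    ∃ c : B →₀ ℝ, (∀ i, 0 ≤ c i) ∧ Finsupp.linearCombination ℝ a c = β := by
  obtain ⟨c, hc⟩ := Finsupp.mem_span_range_iff_exists_finsupp.1 (hS.mem_cone β hβ hpos)
  refine ⟨c.mapRange ((↑) : ℝ≥0 → ℝ) NNReal.coe_zero, fun i ↦ (c i).2, ?_⟩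
  rw [Finsupp.linearCombination_apply, Finsupp.sum_mapRange_index fun i ↦ zero_smul ℝ (a i)]
  exact hc

theorem coeff_nonneg {c : B →₀ ℝ} (hmem : Finsupp.linearCombination ℝ a c ∈ T)
    (hpos : 0 < f (Finsupp.linearCombination ℝ a c)) (i : B) : 0 ≤ c i := by
  obtain ⟨d, hd, hdc⟩ := hS.exists_coeff_nonneg hmem hpos
  exact hS.linearIndependent hdc ▸ hd i

include hT

theorem coeff_nonneg_or_nonpos {c : B →₀ ℝ} (hmem : Finsupp.linearCombination ℝ a c ∈ T) :
    (∀ i, 0 ≤ c i) ∨ ∀ i, c i ≤ 0 := by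
  rcases (hS.regular _ hmem).lt_or_gt with hneg | hpos
  · refine .inr fun i ↦ neg_nonneg.1 (hS.coeff_nonneg (c := -c) ?_ ?_ i)
    · rw [map_neg]
      exact hT.neg_mem _ hmem
    · rw [map_neg, map_neg]
      exact neg_pos.2 hneg
  · exact .inl (hS.coeff_nonneg hmem hpos)

theorem mul_nonneg_of_smul_add_smul_mem {i j : B} {x y : ℝ} (hij : i ≠ j)
    (hmem : x • a i + y • a j ∈ T) : 0 ≤ x * y := by
  set c : B →₀ ℝ := Finsupp.single i x + Finsupp.single j y with hc
  have hsum : Finsupp.linearCombination ℝ a c = x • a i + y • a j := by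
    simp only [hc, map_add, Finsupp.linearCombination_single]
  have hi : c i = x := by simp [hc, Finsupp.single_eq_of_ne hij]
  have hj : c j = y := by simp [hc, Finsupp.single_eq_of_ne hij.symm]
  rw [← hi, ← hj]
  rcases hS.coeff_nonneg_or_nonpos hT (hsum ▸ hmem) with h | h
  · exact mul_nonneg (h i) (h j)
  · exact mul_nonneg_of_nonpos_of_nonpos (h i) (h j)

theorem cartanCoeff_nonpos {i j : B} (hij : i ≠ j) : cartanCoeff (a i) (a j) ≤ 0 := by
  have hmem := hT.refl_mem _ (hS.mem i) _ (hS.mem j)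
  have hrefl : refl (a i) (a j) = (-cartanCoeff (a i) (a j)) • a i + (1 : ℝ) • a j := by
    rw [refl_eq_sub_cartanCoeff]
    module
  linarith [hS.mul_nonneg_of_smul_add_smul_mem hT hij (hrefl ▸ hmem)]

theorem refl_pos {β : V} (hβ : β ∈ T) (hpos : 0 < f β) {i : B} (hne : β ≠ a i) :
    0 < f (refl (a i) β) := by
  obtain ⟨c, hc, hcβ⟩ := hS.exists_coeff_nonneg hβ hpos
  have hmem := hT.refl_mem _ (hS.mem i) β hβ
  refine (hS.regular _ hmem).lt_or_gt.resolve_left fun hneg ↦ hne ?_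
  have hexp : Finsupp.linearCombination ℝ a (Finsupp.single i (cartanCoeff (a i) β) - c) =
      -refl (a i) β := by
    rw [map_sub, Finsupp.linearCombination_single, hcβ, refl_eq_sub_cartanCoeff, neg_sub]
  have hcoeff := hS.coeff_nonneg (hexp ▸ hT.neg_mem _ hmem)
    (by rw [hexp, map_neg]; exact neg_pos.2 hneg)
  have hsingle : c = Finsupp.single i (c i) := Finsupp.ext fun j ↦ by
    rcases eq_or_ne j i with rfl | hj
    · rw [Finsupp.single_eq_same]
    · have := hcoeff j
      rw [Finsupp.sub_apply, Finsupp.single_eq_of_ne hj] at this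
      rw [Finsupp.single_eq_of_ne hj]
      linarith [hc j]
  have hβi : β = c i • a i := by rw [← hcβ, hsingle, Finsupp.linearCombination_single, ← hsingle]
  have hnorm := hT.norm_eq hβ (hS.mem i)
  rw [hβi, norm_smul, Real.norm_of_nonneg (hc i),
    mul_eq_right₀ (norm_ne_zero_iff.2 (hT.ne_zero (hS.mem i)))] at hnorm
  rw [hβi, hnorm, one_smul]

theorem exists_inner_pos {β : V} (hβ : β ∈ T) (hpos : 0 < f β) : ∃ i, 0 < ⟪a i, β⟫ := by
  obtain ⟨c, hc, hcβ⟩ := hS.exists_coeff_nonneg hβ hpos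
  by_contra! hle
  have hsum : ⟪β, β⟫ = ∑ i ∈ c.support, c i * ⟪a i, β⟫ := by
    nth_rw 1 [← hcβ]
    simp only [Finsupp.linearCombination_apply, Finsupp.sum, sum_inner, real_inner_smul_left]
  have hββ : 0 < ⟪β, β⟫ := real_inner_self_pos.2 (hT.ne_zero hβ)
  rw [hsum] at hββ
  exact hββ.not_ge (Finset.sum_nonpos fun i _ ↦ mul_nonpos_of_nonneg_of_nonpos (hc i) (hle i))

theorem positive_root_induction {p : V → Prop} (simple : ∀ i, p (a i))
    (step : ∀ i, ∀ β ∈ T, 0 < f β → p β → p (refl (a i) β)) {β : V} (hβ : β ∈ T)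
    (hpos : 0 < f β) : p β := by
  by_contra hp
  -- A positive root of least height among those violating `p` is lowered by a simple reflection.
  obtain ⟨γ, ⟨hγ, hγpos, hγp⟩, hmin⟩ := {β ∈ T | 0 < f β ∧ ¬ p β}.exists_min_image f
    (hT.finite.subset (Set.sep_subset _ _)) ⟨β, hβ, hpos, hp⟩
  obtain ⟨i, hi⟩ := hS.exists_inner_pos hT hγ hγpos
  have hk : 0 < cartanCoeff (a i) γ :=
    div_pos (by linarith) (real_inner_self_pos.2 (hT.ne_zero (hS.mem i)))
  have hlt : f (refl (a i) γ) < f γ := by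
    rw [refl_eq_sub_cartanCoeff, map_sub, map_smul, smul_eq_mul]
    linarith [mul_pos hk (hS.pos i)]
  have hδ := hT.refl_mem _ (hS.mem i) γ hγ
  have hδpos := hS.refl_pos hT hγ hγpos (i := i) (by rintro rfl; exact hγp (simple i))
  have hδp : p (refl (a i) γ) := by
    by_contra hδp
    exact hlt.not_ge (hmin _ ⟨hδ, hδpos, hδp⟩)
  exact hγp (by simpa using step i _ hδ hδpos hδp)

theorem root_induction {p : V → Prop} (simple : ∀ i, p (a i))
    (step : ∀ i, ∀ β ∈ T, p β → p (refl (a i) β)) {β : V} (hβ : β ∈ T) : p β := by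
  have key {β : V} (hβ : β ∈ T) (hpos : 0 < f β) : p β ∧ p (-β) := by
    refine hS.positive_root_induction hT (p := fun β ↦ p β ∧ p (-β))
      (fun i ↦ ⟨simple i, ?_⟩) (fun i β hβ _ h ↦ ⟨step i β hβ h.1, ?_⟩) hβ hpos
    · rw [← refl_self]
      exact step i _ (hS.mem i) (simple i)
    · rw [← map_neg]
      exact step i _ (hT.neg_mem β hβ) h.2
  rcases (hS.regular β hβ).lt_or_gt with hneg | hpos
  · simpa using (key (hT.neg_mem β hβ) (by simpa using hneg)).2
  · exact (key hβ hpos).1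

theorem closure_range_refl :
    Subgroup.closure (Set.range fun i ↦ refl (a i)) = reflectionGroup T := by
  refine le_antisymm ((Subgroup.closure_le _).2 ?_) ((Subgroup.closure_le _).2 ?_)
  · rintro _ ⟨i, rfl⟩
    exact refl_mem_reflectionGroup (hS.mem i)
  · have hsimple (i : B) : refl (a i) ∈ Subgroup.closure (Set.range fun i ↦ refl (a i)) :=
      Subgroup.subset_closure ⟨i, rfl⟩
    rintro _ ⟨β, hβ, rfl⟩
    refine hS.root_induction hT (p := fun β ↦ refl β ∈ Subgroup.closure _) hsimple ?_ hβ
    intro i β _ hβ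
    rw [← conj_refl]
    exact mul_mem (mul_mem (hsimple i) hβ) (inv_mem (hsimple i))

theorem span_range : Submodule.span ℝ (Set.range a) = Submodule.span ℝ T := by
  refine le_antisymm (Submodule.span_mono (Set.range_subset_iff.2 hS.mem))
    (Submodule.span_le.2 fun β hβ ↦ ?_)
  have hsimple (i : B) : a i ∈ Submodule.span ℝ (Set.range a) :=
    Submodule.subset_span (Set.mem_range_self i)
  refine hS.root_induction hT hsimple (fun i β _ h ↦ ?_) hβ
  rw [refl_eq_sub_cartanCoeff]
  exact sub_mem h (Submodule.smul_mem _ _ (hsimple i))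

theorem rank_eq_card [Fintype B] : rank T = Fintype.card B := by
  rw [rank, ← hS.span_range hT, finrank_span_eq_card hS.linearIndependent]

theorem hasCoxeterType {M : CoxeterMatrix B} (ha : HasCoxeterAngles a M) : HasCoxeterType T M := by
  obtain ⟨cs, hcs⟩ := ha.exists_coxeterSystem hS.pos (hS.closure_range_refl hT)
  refine ⟨a, hS.mem, hS.linearIndependent, hS.span_range hT, fun i j ↦ ?_, cs,
    fun i ↦ Subtype.ext (hcs i)⟩
  rw [inner_eq_cartanCoeff, ha, hT.norm_eq (hS.mem j) (hS.mem i)]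
  ring

end IsSimpleSystem

/-! ### Coxeter diagrams with a golden edge -/

theorem dotProduct_mulVec_pos_of_le {n : Type*} [Fintype n] {M A : Matrix n n ℝ} (hM : M.PosDef)
    (hMA : ∀ i j, M i j ≤ A i j) {w : n → ℝ} (hw : 0 ≤ w) (hw0 : w ≠ 0) :
    0 < w ⬝ᵥ A.mulVec w :=
  calc 0 < w ⬝ᵥ M.mulVec w := hM.dotProduct_mulVec_pos hw0
    _ ≤ w ⬝ᵥ A.mulVec w := Finset.sum_le_sum fun i _ ↦ mul_le_mul_of_nonneg_left
      (Finset.sum_le_sum fun j _ ↦ mul_le_mul_of_nonneg_right (hMA i j) (hw j)) (hw i)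

/-- The Cartan matrix of an indecomposable simple system over `ℤ[φ]`, encoding a Coxeter diagram
all of whose edges have label `3` (entry `-1`) or `5` (entry `-φ`, a golden edge). -/
structure IsGoldenCartanMatrix {B : Type*} (C : Matrix B B ℝ) : Prop where
  posDef : C.PosDef
  diag : ∀ i, C i i = 2
  off_diag : ∀ i j, i ≠ j → C i j = 0 ∨ C i j = -1 ∨ C i j = -φ
  connected : ∀ S : Set B, S.Nonempty → Sᶜ.Nonempty → ∃ i ∈ S, ∃ j ∉ S, C i j ≠ 0

namespace IsGoldenCartanMatrix

variable {B : Type*} {C : Matrix B B ℝ} (hC : IsGoldenCartanMatrix C) {x y z w u : B}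
include hC

theorem symm (i j : B) : C i j = C j i := hC.posDef.isHermitian.apply j i

theorem nonpos {i j : B} (hij : i ≠ j) : C i j ≤ 0 := by
  rcases hC.off_diag i j hij with h | h | h <;> linarith [Real.goldenRatio_pos]

theorem le_neg_one {i j : B} (hij : i ≠ j) (h0 : C i j ≠ 0) : C i j ≤ -1 := by
  rcases hC.off_diag i j hij with h | h | h
  · exact absurd h h0
  · exact h.le
  · linarith [Real.one_lt_goldenRatio]

theorem dotProduct_mulVec_pos_of_nodup {n : ℕ} {g : Fin n → B} (hg : (List.ofFn g).Nodup)
    {A : Matrix (Fin n) (Fin n) ℝ} (hA : A.IsSymm) (hdiag : ∀ p, A p p = 2)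
    (hle : ∀ p q, p < q → A p q = 0 ∨ C (g p) (g q) ≤ A p q) {w : Fin n → ℝ} (hw : 0 ≤ w)
    (hw0 : w ≠ 0) : 0 < w ⬝ᵥ A.mulVec w := by
  rw [List.nodup_ofFn] at hg
  have hlt (p q : Fin n) (hpq : p < q) : C (g p) (g q) ≤ A p q := by
    rcases hle p q hpq with h | h
    · exact h ▸ hC.nonpos (hg.ne hpq.ne)
    · exact h
  refine dotProduct_mulVec_pos_of_le (hC.posDef.submatrix hg) (fun p q ↦ ?_) hw hw0
  rw [Matrix.submatrix_apply]
  rcases lt_trichotomy p q with h | rfl | h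
  · exact hlt p q h
  · rw [hC.diag, hdiag]
  · rw [hC.symm, ← hA.apply]
    exact hlt q p h

-- In each forbidden diagram below, `w` is a nonnegative vector on which the quadratic form of the
-- corresponding Cartan matrix `A` is not positive.
theorem not_golden_path_golden (hd : [x, y, z].Nodup) (hxy : C x y = -φ) (hyz : C y z = -φ) :
    False := by
  have hpos := hC.dotProduct_mulVec_pos_of_nodup (g := ![x, y, z]) (by simpa using hd)
    (A := !![2, -φ, 0; -φ, 2, -φ; 0, -φ, 2])
    (w := ![1, φ, 1]) (by simp [Matrix.IsSymm.ext_iff, Fin.forall_fin_succ])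
    (by simp [Fin.forall_fin_succ]) (by simp [Fin.forall_fin_succ, hxy, hyz])
    (by simp [Pi.le_def, Fin.forall_fin_succ, Real.goldenRatio_pos.le]) (by simp)
  simp only [Matrix.mulVec, dotProduct, Fin.sum_univ_three, Matrix.of_apply,
    Matrix.cons_val] at hpos
  nlinarith [Real.goldenRatio_sq, Real.one_lt_goldenRatio]

theorem not_golden_triangle (hd : [x, y, z].Nodup) (hxy : C x y = -φ) (hxz : C x z ≤ -1)
    (hyz : C y z ≤ -1) : False := by
  have hpos := hC.dotProduct_mulVec_pos_of_nodup (g := ![x, y, z]) (by simpa using hd)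
    (A := !![2, -φ, -1; -φ, 2, -1; -1, -1, 2])
    (w := ![1, 1, 1]) (by simp [Matrix.IsSymm.ext_iff, Fin.forall_fin_succ])
    (by simp [Fin.forall_fin_succ]) (by simp [Fin.forall_fin_succ, hxy, hxz, hyz])
    (by simp [Pi.le_def, Fin.forall_fin_succ]) (by simp)
  simp only [Matrix.mulVec, dotProduct, Fin.sum_univ_three, Matrix.of_apply,
    Matrix.cons_val] at hpos
  nlinarith [Real.goldenRatio_sq, Real.one_lt_goldenRatio]

theorem not_path_golden_path (hd : [x, y, z, w].Nodup) (hxy : C x y = -φ) (hyz : C y z ≤ -1)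
    (hxw : C x w ≤ -1) : False := by
  have hpos := hC.dotProduct_mulVec_pos_of_nodup (g := ![x, y, z, w]) (by simpa using hd)
    (A := !![2, -φ, 0, -1; -φ, 2, -1, 0; 0, -1, 2, 0; -1, 0, 0, 2])
    (w := ![2, 2, 1, 1]) (by simp [Matrix.IsSymm.ext_iff, Fin.forall_fin_succ])
    (by simp [Fin.forall_fin_succ]) (by simp [Fin.forall_fin_succ, hxy, hyz, hxw])
    (by simp [Pi.le_def, Fin.forall_fin_succ]) (by simp)
  simp only [Matrix.mulVec, dotProduct, Fin.sum_univ_four, Matrix.of_apply,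
    Matrix.cons_val] at hpos
  nlinarith [Real.goldenRatio_sq, Real.one_lt_goldenRatio]

theorem not_golden_fork (hd : [x, y, z, w].Nodup) (hxy : C x y = -φ) (hyz : C y z ≤ -1)
    (hyw : C y w ≤ -1) : False := by
  have hpos := hC.dotProduct_mulVec_pos_of_nodup (g := ![x, y, z, w]) (by simpa using hd)
    (A := !![2, -φ, 0, 0; -φ, 2, -1, -1; 0, -1, 2, 0; 0, -1, 0, 2])
    (w := ![φ, 2, 1, 1]) (by simp [Matrix.IsSymm.ext_iff, Fin.forall_fin_succ])
    (by simp [Fin.forall_fin_succ]) (by simp [Fin.forall_fin_succ, hxy, hyz, hyw])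
    (by simp [Pi.le_def, Fin.forall_fin_succ, Real.goldenRatio_pos.le]) (by simp)
  simp only [Matrix.mulVec, dotProduct, Fin.sum_univ_four, Matrix.of_apply,
    Matrix.cons_val] at hpos
  nlinarith [Real.goldenRatio_sq, Real.one_lt_goldenRatio]

theorem not_golden_path_path_golden (hd : [x, y, z, w].Nodup) (hxy : C x y = -φ)
    (hyz : C y z ≤ -1) (hzw : C z w = -φ) : False := by
  have hpos := hC.dotProduct_mulVec_pos_of_nodup (g := ![x, y, z, w]) (by simpa using hd)
    (A := !![2, -φ, 0, 0; -φ, 2, -1, 0; 0, -1, 2, -φ; 0, 0, -φ, 2])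
    (w := ![φ, 2, 2, φ]) (by simp [Matrix.IsSymm.ext_iff, Fin.forall_fin_succ])
    (by simp [Fin.forall_fin_succ]) (by simp [Fin.forall_fin_succ, hxy, hyz, hzw])
    (by simp [Pi.le_def, Fin.forall_fin_succ, Real.goldenRatio_pos.le]) (by simp)
  simp only [Matrix.mulVec, dotProduct, Fin.sum_univ_four, Matrix.of_apply,
    Matrix.cons_val] at hpos
  nlinarith [Real.goldenRatio_sq, Real.one_lt_goldenRatio]

theorem not_golden_path_fork (hd : [x, y, z, w, u].Nodup) (hxy : C x y = -φ)
    (hyz : C y z ≤ -1) (hzw : C z w ≤ -1) (hzu : C z u ≤ -1) : False := by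
  have hpos := hC.dotProduct_mulVec_pos_of_nodup (g := ![x, y, z, w, u]) (by simpa using hd)
    (A := !![2, -φ, 0, 0, 0; -φ, 2, -1, 0, 0; 0, -1, 2, -1, -1; 0, 0, -1, 2, 0; 0, 0, -1, 0, 2])
    (w := ![φ, 2, 2, 1, 1]) (by simp [Matrix.IsSymm.ext_iff, Fin.forall_fin_succ])
    (by simp [Fin.forall_fin_succ]) (by simp [Fin.forall_fin_succ, hxy, hyz, hzw, hzu])
    (by simp [Pi.le_def, Fin.forall_fin_succ, Real.goldenRatio_pos.le]) (by simp)
  simp only [Matrix.mulVec, dotProduct, Fin.sum_univ_five, Matrix.of_apply,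
    Matrix.cons_val] at hpos
  nlinarith [Real.goldenRatio_sq, Real.one_lt_goldenRatio]

theorem not_golden_path_of_length_four (hd : [x, y, z, w, u].Nodup) (hxy : C x y = -φ)
    (hyz : C y z ≤ -1) (hzw : C z w ≤ -1) (hwu : C w u ≤ -1) : False := by
  have hpos := hC.dotProduct_mulVec_pos_of_nodup (g := ![x, y, z, w, u]) (by simpa using hd)
    (A := !![2, -φ, 0, 0, 0; -φ, 2, -1, 0, 0; 0, -1, 2, -1, 0; 0, 0, -1, 2, -1; 0, 0, 0, -1, 2])
    (w := ![2 * φ, 4, 3, 2, 1]) (by simp [Matrix.IsSymm.ext_iff, Fin.forall_fin_succ])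
    (by simp [Fin.forall_fin_succ]) (by simp [Fin.forall_fin_succ, hxy, hyz, hzw, hwu])
    (by simp [Pi.le_def, Fin.forall_fin_succ, Real.goldenRatio_pos.le]) (by simp)
  simp only [Matrix.mulVec, dotProduct, Fin.sum_univ_five, Matrix.of_apply,
    Matrix.cons_val] at hpos
  nlinarith [Real.goldenRatio_sq, Real.one_lt_goldenRatio]

end IsGoldenCartanMatrix

theorem neg_two_mul_cos_pi_div_five : -2 * cos (pi / 5) = -φ := by
  rw [Real.cos_pi_div_five, Real.goldenRatio]
  ring

/-- The diagram with Cartan matrix `C` is the Coxeter diagram of `M`, up to an enumeration of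
its vertices. -/
def HasCoxeterDiagram {B B' : Type*} (C : Matrix B B ℝ) (M : CoxeterMatrix B') : Prop :=
  ∃ e : B' ≃ B, ∀ i j, C (e i) (e j) = -2 * cos (pi / M i j)

namespace IsGoldenCartanMatrix

variable {B : Type*} {C : Matrix B B ℝ} (hC : IsGoldenCartanMatrix C) {x y z w u : B}
include hC

theorem hasCoxeterDiagram_of_enumeration {n : ℕ} {g : Fin n → B} {M : CoxeterMatrix (Fin n)}
    (hg : (List.ofFn g).Nodup) (hsurj : ∀ i, i ∈ List.ofFn g)
    (hM : ∀ p q, p < q → C (g p) (g q) = -2 * cos (pi / M p q)) : HasCoxeterDiagram C M := by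
  have hbij : Function.Bijective g := ⟨List.nodup_ofFn.1 hg, fun i ↦ List.mem_ofFn.1 (hsurj i)⟩
  refine ⟨.ofBijective g hbij, fun p q ↦ ?_⟩
  rw [Equiv.ofBijective_apply, Equiv.ofBijective_apply]
  rcases lt_trichotomy p q with h | rfl | h
  · exact hM p q h
  · rw [hC.diag, M.diagonal, Nat.cast_one, div_one, Real.cos_pi]
    norm_num
  · rw [hC.symm, hM q p h, M.symmetric]

theorem exists_adj_of_exists_notMem {l : List B} (hl : l ≠ []) (h : ∃ i, i ∉ l) :
    ∃ i ∈ l, ∃ j ∉ l, C i j ≠ 0 :=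
  hC.connected {i | i ∈ l} (List.exists_mem_of_ne_nil l hl) h

theorem eq_neg_one_of_adj_golden (hd : [x, y, z].Nodup) (hxy : C x y = -φ) (hyz : C y z ≠ 0) :
    C y z = -1 := by
  rcases hC.off_diag y z (by simp_all) with h | h | h
  · exact absurd h hyz
  · exact h
  · exact (hC.not_golden_path_golden hd hxy h).elim

theorem eq_zero_of_adj_golden (hd : [x, y, z].Nodup) (hxy : C x y = -φ) (hyz : C y z ≤ -1) :
    C x z = 0 := by
  by_contra h
  exact hC.not_golden_triangle hd hxy (hC.le_neg_one (by simp_all) h) hyz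

theorem golden_eq_zero_of_path (hd : [x, y, z, w].Nodup) (hxy : C x y = -φ) (hyz : C y z ≤ -1) :
    C x w = 0 ∧ C y w = 0 := by
  constructor <;> by_contra h
  · exact hC.not_path_golden_path hd hxy hyz (hC.le_neg_one (by simp_all) h)
  · exact hC.not_golden_fork hd hxy hyz (hC.le_neg_one (by simp_all) h)

theorem eq_neg_one_of_adj_path (hd : [x, y, z, w].Nodup) (hxy : C x y = -φ) (hyz : C y z ≤ -1)
    (hzw : C z w ≠ 0) : C z w = -1 := by
  rcases hC.off_diag z w (by simp_all) with h | h | h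
  · exact absurd h hzw
  · exact h
  · exact (hC.not_golden_path_path_golden hd hxy hyz h).elim

theorem hasCoxeterDiagram_H₂ (hd : [x, y].Nodup) (hxy : C x y = -φ) (hall : ∀ i, i ∈ [x, y]) :
    HasCoxeterDiagram C coxeterMatrixH2 := by
  refine hC.hasCoxeterDiagram_of_enumeration (g := ![x, y]) (by simpa using hd)
    (by simpa using hall) ?_
  simp [Fin.forall_fin_two, coxeterMatrixH2_apply, hxy, ← neg_two_mul_cos_pi_div_five]

theorem hasCoxeterDiagram_H₃ (hd : [x, y, z].Nodup) (hxy : C x y = -φ) (hyz : C y z = -1)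
    (hxz : C x z = 0) (hall : ∀ i, i ∈ [x, y, z]) : HasCoxeterDiagram C CoxeterMatrix.H₃ := by
  refine hC.hasCoxeterDiagram_of_enumeration (g := ![z, y, x])
    (by simpa [List.nodup_reverse] using List.nodup_reverse.2 hd)
    (by simpa [or_comm, or_assoc, or_left_comm] using hall) ?_
  simp [Fin.forall_fin_succ, CoxeterMatrix.H₃, hC.symm z, hC.symm y x, hxy, hyz, hxz,
    ← neg_two_mul_cos_pi_div_five]

theorem hasCoxeterDiagram_H₄ (hd : [x, y, z, w].Nodup) (hxy : C x y = -φ) (hyz : C y z = -1)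
    (hzw : C z w = -1) (hxz : C x z = 0) (hxw : C x w = 0) (hyw : C y w = 0)
    (hall : ∀ i, i ∈ [x, y, z, w]) : HasCoxeterDiagram C CoxeterMatrix.H₄ := by
  refine hC.hasCoxeterDiagram_of_enumeration (g := ![w, z, y, x])
    (by simpa [List.nodup_reverse] using List.nodup_reverse.2 hd)
    (by simpa [or_comm, or_assoc, or_left_comm] using hall) ?_
  simp [Fin.forall_fin_succ, CoxeterMatrix.H₄, hC.symm w, hC.symm z x, hC.symm z y, hC.symm y x,
    hxy, hyz, hxz, hxw, hyw, hzw, ← neg_two_mul_cos_pi_div_five]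

theorem mem_of_path (hd : [x, y, z, w].Nodup) (hxy : C x y = -φ) (hyz : C y z ≤ -1)
    (hzw : C z w ≤ -1) (i : B) : i ∈ [x, y, z, w] := by
  by_contra hi
  obtain ⟨i, hi, u, hu, hiu⟩ := hC.exists_adj_of_exists_notMem (by simp) ⟨i, hi⟩
  have hle : C i u ≤ -1 := hC.le_neg_one (by rintro rfl; exact hu hi) hiu
  have hd5 : [x, y, z, w, u].Nodup := by
    simpa using hd.concat hu
  obtain ⟨hxu, hyu⟩ := hC.golden_eq_zero_of_path (w := u) (by simp_all) hxy hyz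
  simp only [List.mem_cons, List.not_mem_nil, or_false] at hi
  rcases hi with rfl | rfl | rfl | rfl
  · exact hiu hxu
  · exact hiu hyu
  · exact hC.not_golden_path_fork hd5 hxy hyz hzw hle
  · exact hC.not_golden_path_of_length_four hd5 hxy hyz hzw hle

theorem hasCoxeterDiagram_H₃_or_H₄ (hd : [x, y, z].Nodup) (hxy : C x y = -φ) (hyz : C y z ≠ 0) :
    HasCoxeterDiagram C CoxeterMatrix.H₃ ∨ HasCoxeterDiagram C CoxeterMatrix.H₄ := by
  have hyz := hC.eq_neg_one_of_adj_golden hd hxy hyz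
  have hxz := hC.eq_zero_of_adj_golden hd hxy hyz.le
  by_cases hall : ∀ i, i ∈ [x, y, z]
  · exact .inl (hC.hasCoxeterDiagram_H₃ hd hxy hyz hxz hall)
  obtain ⟨i, hi, w, hw, hiw⟩ := hC.exists_adj_of_exists_notMem (by simp) (not_forall.1 hall)
  have hd4 : [x, y, z, w].Nodup := by simpa using hd.concat hw
  obtain ⟨hxw, hyw⟩ := hC.golden_eq_zero_of_path hd4 hxy hyz.le
  have hzw : C z w ≠ 0 := by
    simp only [List.mem_cons, List.not_mem_nil, or_false] at hi
    rcases hi with rfl | rfl | rfl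
    · exact absurd hxw hiw
    · exact absurd hyw hiw
    · exact hiw
  have hzw := hC.eq_neg_one_of_adj_path hd4 hxy hyz.le hzw
  exact .inr (hC.hasCoxeterDiagram_H₄ hd4 hxy hyz hzw hxz hxw hyw
    (hC.mem_of_path hd4 hxy hyz.le hzw.le))

theorem hasCoxeterDiagram_of_golden_edge (hne : x ≠ y) (hxy : C x y = -φ) :
    HasCoxeterDiagram C coxeterMatrixH2 ∨ HasCoxeterDiagram C CoxeterMatrix.H₃ ∨
      HasCoxeterDiagram C CoxeterMatrix.H₄ := by
  have hd : [x, y].Nodup := by simpa using hne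
  by_cases hall : ∀ i, i ∈ [x, y]
  · exact .inl (hC.hasCoxeterDiagram_H₂ hd hxy hall)
  obtain ⟨i, hi, z, hz, hiz⟩ := hC.exists_adj_of_exists_notMem (by simp) (not_forall.1 hall)
  simp only [List.mem_cons, List.not_mem_nil, or_false, not_or] at hi hz
  rcases hi with rfl | rfl
  · exact .inr (hC.hasCoxeterDiagram_H₃_or_H₄ (x := y) (y := i) (by grind)
      (hC.symm y i ▸ hxy) hiz)
  · exact .inr (hC.hasCoxeterDiagram_H₃_or_H₄ (x := x) (y := i) (by grind) hxy hiz)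

end IsGoldenCartanMatrix

/-! ### The Cartan matrix of a simple system over `ℤ[φ]` -/

namespace IsRootShellSystem

variable {T : Set V}

theorem exists_cartanCoeff_eq_sq_sub_two {R : Subalgebra ℤ ℝ} (hT : IsRootShellSystem R T)
    {α β : V} (hα : α ∈ T) (hβ : β ∈ T) :
    ∃ γ ∈ T, ∃ δ ∈ T, cartanCoeff γ δ = cartanCoeff α β ^ 2 - 2 := by
  refine ⟨β, hβ, -refl α β, hT.neg_mem _ (hT.refl_mem α hα β hβ), ?_⟩
  calc cartanCoeff β (-refl α β) = cartanCoeff α β * cartanCoeff β α - cartanCoeff β β := by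
        rw [refl_eq_sub_cartanCoeff]
        simp only [cartanCoeff, neg_sub, inner_sub_right, inner_smul_right]
        ring
    _ = cartanCoeff α β ^ 2 - 2 := by
        rw [cartanCoeff_self (hT.ne_zero hβ), hT.cartanCoeff_comm hβ hα, sq]

variable (hT : IsRootShellSystem goldenIntegers T)
include hT

theorem cartanCoeff_cases_of_nonpos {α β : V} (hα : α ∈ T) (hβ : β ∈ T)
    (hgt : -2 < cartanCoeff α β) (hle : cartanCoeff α β ≤ 0) :
    cartanCoeff α β = 0 ∨ cartanCoeff α β = -1 ∨ cartanCoeff α β = -φ ∨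
      cartanCoeff α β = 1 - φ := by
  set C : Set ℝ := Set.image2 cartanCoeff T T
  have hfin : C.Finite := hT.finite.image2 _ hT.finite
  have hC : ∀ x ∈ C, x ^ 2 - 2 ∈ C := by
    rintro _ ⟨γ, hγ, δ, hδ, rfl⟩
    exact hT.exists_cartanCoeff_eq_sq_sub_two hγ hδ
  have hmem : cartanCoeff α β ∈ C := Set.mem_image2_of_mem hα hβ
  obtain ⟨a, b, hab⟩ := exists_int_of_mem_goldenIntegers (hT.cartanCoeff_mem α hα β hβ)
  rw [hab] at hgt hle hmem ⊢
  exact goldenInteger_cases hgt hle (abs_goldenConj_le_two_of_stable hfin hC hmem)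

end IsRootShellSystem

namespace IsSimpleSystem

variable {B : Type*} {R : Subalgebra ℤ ℝ} {T : Set V} {f : Module.Dual ℝ V} {a : B → V}

theorem neg_two_lt_cartanCoeff (hS : IsSimpleSystem T f a) (hT : IsRootShellSystem R T) (i j : B) :
    -2 < cartanCoeff (a i) (a j) := by
  have hsum : a i + a j ≠ 0 := fun h ↦ by
    have hf := congrArg f h
    rw [map_add, map_zero] at hf
    linarith [hS.pos i, hS.pos j]
  have hpos : 0 < ‖a i + a j‖ ^ 2 := by positivity
  rw [norm_add_sq_real, hT.norm_eq (hS.mem j) (hS.mem i), inner_eq_cartanCoeff] at hpos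
  have hnorm : 0 < ‖a i‖ ^ 2 := sq_pos_of_pos (norm_pos_iff.2 (hT.ne_zero (hS.mem i)))
  nlinarith [hnorm, hpos]

theorem rank_and_hasCoxeterType (hS : IsSimpleSystem T f a) (hT : IsRootShellSystem R T)
    {n : ℕ} {M : CoxeterMatrix (Fin n)}
    (h : HasCoxeterDiagram (Matrix.of fun i j ↦ cartanCoeff (a i) (a j)) M) :
    rank T = n ∧ HasCoxeterType T M := by
  obtain ⟨e, he⟩ := h
  refine ⟨?_, (hS.comp_equiv e).hasCoxeterType hT he⟩
  rw [(hS.comp_equiv e).rank_eq_card hT, Fintype.card_fin]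

variable (hS : IsSimpleSystem T f a)
include hS

theorem cartanCoeff_ne_one_sub_goldenRatio (hT : IsRootShellSystem R T) {i j : B} (hij : i ≠ j) :
    cartanCoeff (a i) (a j) ≠ 1 - φ := by
  intro hc
  have hc' : cartanCoeff (a j) (a i) = 1 - φ := by
    rw [hT.cartanCoeff_comm (hS.mem j) (hS.mem i), hc]
  have hmem := hT.refl_mem _ (hS.mem i) _ (hT.refl_mem _ (hS.mem j) _ (hS.mem i))
  have hrefl : refl (a i) (refl (a j) (a i)) = ((1 - φ) ^ 2 - 1) • a i + (φ - 1) • a j := by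
    rw [refl_eq_sub_cartanCoeff (a j), hc', map_sub, map_smul, refl_self,
      refl_eq_sub_cartanCoeff, hc]
    module
  have hnonneg := hS.mul_nonneg_of_smul_add_smul_mem hT hij (hrefl ▸ hmem)
  have hsq : (1 - φ) ^ 2 - 1 = 1 - φ := by linear_combination Real.goldenRatio_sq
  rw [hsq] at hnonneg
  nlinarith [Real.one_lt_goldenRatio]

theorem cartanCoeff_cases (hT : IsRootShellSystem goldenIntegers T) {i j : B} (hij : i ≠ j) :
    cartanCoeff (a i) (a j) = 0 ∨ cartanCoeff (a i) (a j) = -1 ∨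
      cartanCoeff (a i) (a j) = -φ := by
  have hne := hS.cartanCoeff_ne_one_sub_goldenRatio hT hij
  have h := hT.cartanCoeff_cases_of_nonpos (hS.mem i) (hS.mem j) (hS.neg_two_lt_cartanCoeff hT i j)
    (hS.cartanCoeff_nonpos hT hij)
  tauto

theorem posDef_cartanCoeff (hT : IsRootShellSystem R T) :
    (Matrix.of fun i j ↦ cartanCoeff (a i) (a j)).PosDef := by
  obtain ⟨r, hr, hnorm⟩ := hT.single_length
  have hgram : (Matrix.of fun i j ↦ cartanCoeff (a i) (a j)) = (2 / r ^ 2) • Matrix.gram ℝ a := by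
    ext i j
    simp only [Matrix.of_apply, Matrix.smul_apply, Matrix.gram_apply, smul_eq_mul, cartanCoeff,
      real_inner_self_eq_norm_sq, hnorm _ (hS.mem i)]
    ring
  have := hT.finite.to_subtype
  have : Finite B := .of_injective (fun i ↦ (⟨a i, hS.mem i⟩ : T))
    fun i j h ↦ hS.linearIndependent.injective (congrArg Subtype.val h)
  rw [hgram]
  exact (Matrix.posDef_gram_of_linearIndependent hS.linearIndependent).smul (by positivity)

section

variable (hT : IsRootShellSystem R T)
include hT

theorem mem_span_or_mem_span_compl {S : Set B}
    (hortho : Submodule.span ℝ (a '' S) ⟂ Submodule.span ℝ (a '' Sᶜ)) {β : V} (hβ : β ∈ T) :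
    β ∈ Submodule.span ℝ (a '' S) ∨ β ∈ Submodule.span ℝ (a '' Sᶜ) := by
  have hsimple (i : B) :
      a i ∈ Submodule.span ℝ (a '' S) ∨ a i ∈ Submodule.span ℝ (a '' Sᶜ) :=
    (em (i ∈ S)).imp (fun hi ↦ Submodule.subset_span ⟨i, hi, rfl⟩)
      (fun hi ↦ Submodule.subset_span ⟨i, hi, rfl⟩)
  have hstable {N N' : Submodule ℝ V} (hN : N ⟂ N') {i : B} (hi : a i ∈ N ∨ a i ∈ N') {γ : V}
      (hγ : γ ∈ N) : refl (a i) γ ∈ N := by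
    rcases hi with hi | hi
    · rw [refl_eq_sub_cartanCoeff]
      exact N.sub_mem hγ (N.smul_mem _ hi)
    · rwa [refl_apply_of_inner_eq_zero (Submodule.isOrtho_iff_inner_eq.1 hN.symm _ hi _ hγ)]
  refine hS.root_induction hT
    (p := fun β ↦ β ∈ Submodule.span ℝ (a '' S) ∨ β ∈ Submodule.span ℝ (a '' Sᶜ)) hsimple ?_ hβ
  exact fun i γ _ h ↦ h.imp (hstable hortho (hsimple i)) (hstable hortho.symm (hsimple i).symm)

theorem exists_cartanCoeff_ne_zero (hind : IsIndecomposable T) {S : Set B} (hne : S.Nonempty)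
    (hne' : Sᶜ.Nonempty) : ∃ i ∈ S, ∃ j ∉ S, cartanCoeff (a i) (a j) ≠ 0 := by
  by_contra! hzero
  have hortho : Submodule.span ℝ (a '' S) ⟂ Submodule.span ℝ (a '' Sᶜ) := by
    rw [Submodule.isOrtho_span]
    rintro _ ⟨i, hi, rfl⟩ _ ⟨j, hj, rfl⟩
    exact inner_eq_zero_of_cartanCoeff_eq_zero (hzero i hi j hj)
  have hcover : T ∩ Submodule.span ℝ (a '' S) ∪ T ∩ Submodule.span ℝ (a '' Sᶜ) = T := by
    rw [← Set.inter_union_distrib_left, Set.inter_eq_left]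
    exact fun β hβ ↦ hS.mem_span_or_mem_span_compl hT hortho hβ
  have hmem {S : Set B} {i : B} (hi : i ∈ S) : a i ∈ T ∩ Submodule.span ℝ (a '' S) :=
    ⟨hS.mem i, Submodule.subset_span ⟨i, hi, rfl⟩⟩
  rcases hind.2 _ _ hcover fun x hx y hy ↦ Submodule.isOrtho_iff_inner_eq.1 hortho _ hx.2 _ hy.2
    with h | h
  · exact h.subset (hmem hne.some_mem)
  · exact h.subset (hmem hne'.some_mem)

theorem cartanCoeff_mem_of_forall_simple {K : Subring ℝ}
    (hsimple : ∀ i j, cartanCoeff (a i) (a j) ∈ K) {α β : V} (hα : α ∈ T) (hβ : β ∈ T) :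
    cartanCoeff α β ∈ K := by
  have hleft {β : V} (hβ : β ∈ T) : ∀ i, cartanCoeff (a i) β ∈ K := by
    refine hS.root_induction hT (p := fun β ↦ ∀ i, cartanCoeff (a i) β ∈ K)
      (fun j i ↦ hsimple i j) (fun j β _ h i ↦ ?_) hβ
    have hexp : cartanCoeff (a i) (refl (a j) β) =
        cartanCoeff (a i) β - cartanCoeff (a j) β * cartanCoeff (a i) (a j) := by
      rw [refl_eq_sub_cartanCoeff]
      simp only [cartanCoeff, inner_sub_right, real_inner_smul_right]
      ring
    rw [hexp]
    exact sub_mem (h i) (mul_mem (h j) (hsimple i j))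
  refine hS.root_induction hT (p := fun α ↦ ∀ β ∈ T, cartanCoeff α β ∈ K)
    (fun i β hβ ↦ hleft hβ i) (fun i α _ h β hβ ↦ ?_) hα β hβ
  have hadj : cartanCoeff (refl (a i) α) β = cartanCoeff α (refl (a i) β) := by
    conv_lhs => rw [← refl_refl (a i) β]
    simp only [cartanCoeff, LinearIsometryEquiv.inner_map_map]
  exact hadj ▸ h _ (hT.refl_mem _ (hS.mem i) β hβ)

end

theorem exists_golden_edge (hT : IsRootShellSystem goldenIntegers T)
    (hnc : IsNonCrystallographic T) : ∃ i j, i ≠ j ∧ cartanCoeff (a i) (a j) = -φ := by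
  by_contra! hnone
  have hint (i j : B) : cartanCoeff (a i) (a j) ∈ (Int.castRingHom ℝ).range := by
    rcases eq_or_ne i j with rfl | hij
    · exact ⟨2, by simp [cartanCoeff_self (hT.ne_zero (hS.mem i))]⟩
    rcases hS.cartanCoeff_cases hT hij with h | h | h
    · exact ⟨0, by simp [h]⟩
    · exact ⟨-1, by simp [h]⟩
    · exact absurd h (hnone i j hij)
  obtain ⟨α, hα, β, hβ, hαβ⟩ := hnc
  obtain ⟨n, hn⟩ := hS.cartanCoeff_mem_of_forall_simple hT hint hα hβ
  exact hαβ n hn.symm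

theorem isGoldenCartanMatrix (hT : IsRootShellSystem goldenIntegers T)
    (hind : IsIndecomposable T) :
    IsGoldenCartanMatrix (Matrix.of fun i j ↦ cartanCoeff (a i) (a j)) where
  posDef := hS.posDef_cartanCoeff hT
  diag i := cartanCoeff_self (hT.ne_zero (hS.mem i))
  off_diag _ _ hij := hS.cartanCoeff_cases hT hij
  connected _ hne hne' := hS.exists_cartanCoeff_ne_zero hT hind hne hne'

end IsSimpleSystem

end RootShell

theorem theorem6p1_general {V : Type*} [NormedAddCommGroup V] [InnerProductSpace ℝ V] (T : Set V)
    (hT : RootShell.IsRootShellSystem RootShell.goldenIntegers T)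
    (hind : RootShell.IsIndecomposable T) (hnc : RootShell.IsNonCrystallographic T) :
    RootShell.rank T ∈ ({2, 3, 4} : Set ℕ) ∧
      ((RootShell.rank T = 2 ∧ RootShell.HasCoxeterType T RootShell.coxeterMatrixH2) ∨
        (RootShell.rank T = 3 ∧ RootShell.HasCoxeterType T CoxeterMatrix.H₃) ∨
        (RootShell.rank T = 4 ∧ RootShell.HasCoxeterType T CoxeterMatrix.H₄)) := by
  obtain ⟨Δ, f, hΔ⟩ := hT.exists_isSimpleSystem
  obtain ⟨x, y, hne, hxy⟩ := hΔ.exists_golden_edge hT hnc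
  have hdiagram := (hΔ.isGoldenCartanMatrix hT hind).hasCoxeterDiagram_of_golden_edge hne hxy
  have htype := hdiagram.imp (hΔ.rank_and_hasCoxeterType hT)
    (Or.imp (hΔ.rank_and_hasCoxeterType hT) (hΔ.rank_and_hasCoxeterType hT))
  refine ⟨?_, htype⟩
  rcases htype with h | h | h <;> simp [h.1]

theorem theorem6p1 {V : Type*} [NormedAddCommGroup V] [InnerProductSpace ℝ V]
    [FiniteDimensional ℝ V] (T : Set V)
    (hT : RootShell.IsRootShellSystem RootShell.goldenIntegers T)
    (hind : RootShell.IsIndecomposable T) (hnc : RootShell.IsNonCrystallographic T) :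
    RootShell.rank T ∈ ({2, 3, 4} : Set ℕ) ∧
      ((RootShell.rank T = 2 ∧ RootShell.HasCoxeterType T RootShell.coxeterMatrixH2) ∨
        (RootShell.rank T = 3 ∧ RootShell.HasCoxeterType T CoxeterMatrix.H₃) ∨
        (RootShell.rank T = 4 ∧ RootShell.HasCoxeterType T CoxeterMatrix.H₄)) :=
  theorem6p1_general T hT hind hnc
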